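/- Let $\Delta$ be a simplicial complex with vertices in $[n]$ (containing the empty face) and write $|\Delta|=\bigcup_{F\in\Delta}F$. For $d=(d_1,\dots,d_n)$ let $A_{\Delta,d}$ be the $0/1$-matrix that computes the margins of a $d_1\times\cdots\times d_n$ table along the facets of $\Delta$: its columns are indexed by the cells $i\in\prod_{j}[d_j]$, its rows by the pairs $(F,e)$ with $F$ a facet of $\Delta$ and $e\in\prod_{j\in F}[d_j]$, and the entry is $1$ if $i_j=e_j$ for all $j\in F$, and $0$ otherwise. A Markov basis of a nonnegative integer matrix $A$ is a finite set $\mathcal M\subset\ker_{\mathbb Z}(A)$ such that for all nonnegative integer vectors $t,u$ with $At=Au$ there are $s \ge 0$ and $v_1,\dots,v_s\in\mathcal M$ with $t+\sum_{i=1}^p v_i\ge 0$ for $1\le p\le s$ and $t+\sum_{i=1}^s v_i=u$. It is minimal if no proper subset of it is a Markov basis of $A$. The universal Markov basis $\mathcal M_{\Delta,d}$ is the union of all minimal Markov bases of $A_{\Delta,d}$. The format of an integer table $u$ is $r_1\times\cdots\times r_n$, where $r_i$ is the number of levels $k\in[d_i]$ for which the slice of $u$ with $i$-th index equal to $k$ is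 not identically zero. Suppose that $\Delta$ is reducible with decomposition $(\Delta_1,S,\Delta_2)$, that is, $\Delta_1,\Delta_2$ are simplicial complexes with $S\in\Delta_1$, $S\in\Delta_2$, $|\Delta_1|\cap|\Delta_2|=S$ and $\Delta=\Delta_1\cup\Delta_2$. Suppose that $1\in|\Delta_1|\setminus|\Delta_2|$ and $2\in|\Delta_2|\setminus|\Delta_1|$. Let $d_3,\dots,d_n$ be given positive integers. Then there are constants $m_1,m_2$, depending only on $\Delta$ and $d_3,\dots,d_n$, such that for all positive integers $d_1,d_2$ every element of the universal Markov basis $\mathcal M_{\Delta,d}$, where $d=(d_1,d_2,d_3,\dots,d_n)$, has format $r_1\times r_2\times\cdots\times r_n$ with $r_1<m_1$, $r_2<m_2$ and $r_i\le d_i$ for $3\le i\le n$. -/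

import Mathlib

open Finset Matrix

/-- An abstract simplicial complex whose vertices lie in `V`: a family of finite sets that is closed
under taking subsets and contains the empty face. (The empty face is included, so that a complex may
be glued along it. Points of `V` need not be vertices.) -/
structure TableComplex (V : Type*) where
  faces : Set (Finset V)
  empty_mem : ∅ ∈ faces
  down_closed : ∀ F ∈ faces, ∀ G : Finset V, G ⊆ F → G ∈ faces

namespace TableComplex

variable {V : Type*}

/-- The facets, i.e. the inclusion-maximal faces. -/
def facets (Δ : TableComplex V) : Set (Finset V) :=
  {F | F ∈ Δ.faces ∧ ∀ G ∈ Δ.faces, F ⊆ G → F = G}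

/-- The underlying set `|Δ|`, the union of all faces. -/
def support (Δ : TableComplex V) : Set V :=
  {v | ∃ F ∈ Δ.faces, v ∈ F}

/-- `Δ` is reducible with decomposition `(Δ₁, S, Δ₂)`. -/
structure IsReducible (Δ Δ₁ : TableComplex V) (S : Finset V) (Δ₂ : TableComplex V) : Prop where
  mem_left : S ∈ Δ₁.faces
  mem_right : S ∈ Δ₂.faces
  support_inter : Δ₁.support ∩ Δ₂.support = (S : Set V)
  faces_eq : Δ.faces = Δ₁.faces ∪ Δ₂.faces

/-- The cells (index vectors) of a table with `d i` levels in direction `i`. -/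
abbrev Cell (d : V → ℕ) : Type _ := (i : V) → Fin (d i)

/-- The rows of the matrix of the hierarchical model: pairs `(F, e)` of a facet `F` of `Δ` and an
index vector `e` of the `F`-margin. -/
abbrev Row (Δ : TableComplex V) (d : V → ℕ) : Type _ :=
  (F : Δ.facets) × ((j : {j : V // j ∈ F.1}) → Fin (d j.1))

/-- The `0/1`-matrix `A_Δ` of the hierarchical model, which computes all the facet margins of a
table: the entry in row `(F, e)` and column `i` is `1` if `i` restricts to `e` on `F`. -/
def modelMatrix (Δ : TableComplex V) (d : V → ℕ) : Matrix (Δ.Row d) (Cell d) ℕ :=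
  Matrix.of fun r i => if ∀ j : {j : V // j ∈ r.1.1}, i j.1 = r.2 j then 1 else 0

/-- The format of an integer table `u`: in direction `i`, the number of levels `k` for which the
slice `{c | c i = k}` of `u` is not identically zero. -/
noncomputable def format {d : V → ℕ} (u : Cell d → ℤ) (i : V) : ℕ :=
  Set.ncard {k : Fin (d i) | ∃ c : Cell d, c i = k ∧ u c ≠ 0}

end TableComplex

/-- A Markov basis of a nonnegative integer matrix `A`: a finite set of vectors in the integer kernel
of `A` such that any two nonnegative integer vectors `t`, `u` in the same fiber of `A` are connected
by a sequence of moves in `M`, staying nonnegative after every step. -/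
structure IsMarkovBasis {ι κ : Type*} [Fintype κ] (A : Matrix ι κ ℕ) (M : Set (κ → ℤ)) : Prop where
  finite : M.Finite
  mem_ker : ∀ v ∈ M, A.map (fun a : ℕ => (a : ℤ)) *ᵥ v = 0
  connected : ∀ t u : κ → ℕ, A *ᵥ t = A *ᵥ u →
    ∃ (s : ℕ) (v : ℕ → κ → ℤ), (∀ i < s, v i ∈ M) ∧
      (∀ p ≤ s, ∀ k, 0 ≤ (t k : ℤ) + ∑ i ∈ Finset.range p, v i k) ∧
      ∀ k, (t k : ℤ) + ∑ i ∈ Finset.range s, v i k = (u k : ℤ)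

/-- A Markov basis no proper subset of which is a Markov basis. -/
def IsMinimalMarkovBasis {ι κ : Type*} [Fintype κ] (A : Matrix ι κ ℕ) (M : Set (κ → ℤ)) : Prop :=
  IsMarkovBasis A M ∧ ∀ N : Set (κ → ℤ), N ⊂ M → ¬ IsMarkovBasis A N

/-- The universal Markov basis: the union of all minimal Markov bases. -/
def universalMarkovBasis {ι κ : Type*} [Fintype κ] (A : Matrix ι κ ℕ) : Set (κ → ℤ) :=
  {v | ∃ M : Set (κ → ℤ), IsMinimalMarkovBasis A M ∧ v ∈ M}

/-! ### Splitting multisets -/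

namespace Multiset

/-! It suffices to connect all fibers of the model by moves of degree at most some `D` that does not
depend on the first two level counts. Moves preserve the total of a table, so any Markov basis joins
the two sides of such a move by elements of norm at most `2 * D`. These elements alone form a Markov
basis, so a minimal basis has no others, and an element of norm at most `2 * D` meets at most `2 *
D` levels in each direction.

To connect a fiber over a reducible complex, lift moves of each part by pairing cells that agree on
`S`, then repair the gluing by quadratic swaps (`IsReducible.reflTransGen_moveStep`). Each part sees
only one direction of unbounded size. Its pairs of tables with equal margins form a higher Lawrence
lifting, and these split into pairs of bounded size (`exists_bound_lawrence`). The source of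
finiteness is Dickson's lemma, the instance below: it makes the equalizers of additive maps on such
multisets finitely generated. -/

instance wellQuasiOrderedLE_of_finite {α : Type*} [Finite α] :
    WellQuasiOrderedLE (Multiset α) := by
  classical
  exact (Finsupp.orderIsoMultiset (ι := α)).monotone.wellQuasiOrderedLE_of_wellQuasiOrderedLE_of_surjective
    (Finsupp.orderIsoMultiset (ι := α)).surjective

theorem exists_add_of_map_eq_add {α β : Type*} (f : α → β) (a b : Multiset β) (s : Multiset α)
    (h : s.map f = a + b) :
    ∃ s₁ s₂ : Multiset α, s = s₁ + s₂ ∧ s₁.map f = a ∧ s₂.map f = b := by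
  classical
  induction a using Multiset.induction_on generalizing s with
  | empty => exact ⟨0, s, by simp, by simp, by simpa using h⟩
  | cons x a ih =>
    rw [cons_add, ← map_eq_cons] at h
    obtain ⟨y, hy, rfl, h⟩ := h
    obtain ⟨s₁, s₂, hs, h₁, h₂⟩ := ih _ h
    exact ⟨y ::ₘ s₁, s₂, by rw [cons_add, ← hs, cons_erase hy], by rw [map_cons, h₁], h₂⟩

/-- If decompositions into two summands lift along an additive map, so do all finite ones. -/
theorem exists_multiset_sum_of_splitting {M N : Type*} [AddCommMonoid M] [AddCommMonoid N]
    (φ : M → N) (h₀ : ∀ s, φ s = 0 → s = 0)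
    (hφ : ∀ s a b, φ s = a + b → ∃ s₁ s₂, s = s₁ + s₂ ∧ φ s₁ = a ∧ φ s₂ = b)
    (l : Multiset N) (s : M) (h : φ s = l.sum) :
    ∃ l' : Multiset M, l'.sum = s ∧ l'.map φ = l := by
  induction l using Multiset.induction_on generalizing s with
  | empty => exact ⟨0, by simpa using (h₀ s (by simpa using h)).symm, by simp⟩
  | cons x l ih =>
    rw [sum_cons] at h
    obtain ⟨s₁, s₂, rfl, rfl, h₂⟩ := hφ _ _ _ h
    obtain ⟨l', rfl, rfl⟩ := ih _ h₂
    exact ⟨s₁ ::ₘ l', by simp, by simp⟩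

theorem exists_sum_of_map_eq_sum {α β : Type*} (f : α → β) (l : Multiset (Multiset β))
    (s : Multiset α) (h : s.map f = l.sum) :
    ∃ l' : Multiset (Multiset α), l'.sum = s ∧ l'.map (map f) = l :=
  exists_multiset_sum_of_splitting (map f) (fun s hs => by simpa using hs)
    (fun s a b hs => exists_add_of_map_eq_add f a b s hs) l s h

theorem exists_sum_of_prodMap_eq_sum {α β : Type*} (f : α → β)
    (l : Multiset (Multiset β × Multiset β)) (s : Multiset α × Multiset α)
    (h : (s.1.map f, s.2.map f) = l.sum) :
    ∃ l' : Multiset (Multiset α × Multiset α), l'.sum = s ∧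
      l'.map (fun p => (p.1.map f, p.2.map f)) = l := by
  refine exists_multiset_sum_of_splitting
    (fun p : Multiset α × Multiset α => (p.1.map f, p.2.map f)) (fun s hs => ?_)
    (fun s a b hs => ?_) l s h
  · simpa [Prod.ext_iff] using hs
  · simp only [Prod.ext_iff, Prod.fst_add, Prod.snd_add] at hs
    obtain ⟨s₁, s₂, h, h₁, h₂⟩ := exists_add_of_map_eq_add f _ _ _ hs.1
    obtain ⟨t₁, t₂, k, k₁, k₂⟩ := exists_add_of_map_eq_add f _ _ _ hs.2
    exact ⟨(s₁, t₁), (s₂, t₂), by simp [Prod.ext_iff, h, k], by simp [h₁, k₁], by simp [h₂, k₂]⟩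

theorem exists_sum_of_mem_closure {M : Type*} [AddCommMonoid M] {s : Finset M} {x : M}
    (hx : x ∈ AddSubmonoid.closure (s : Set M)) : ∃ l : Multiset {x // x ∈ s}, (l.map Subtype.val).sum = x := by
  induction hx using AddSubmonoid.closure_induction with
  | mem x hx => exact ⟨{⟨x, hx⟩}, by simp⟩
  | zero => exact ⟨0, by simp⟩
  | add x y _ _ hx hy =>
    obtain ⟨l, rfl⟩ := hx
    obtain ⟨l', rfl⟩ := hy
    exact ⟨l + l', by simp⟩

theorem map_eq_map_of_factors {α β γ : Type*} {f : α → β} {g : α → γ}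
    (hfg : ∀ a b, f a = f b → g a = g b) {s t : Multiset α} (h : s.map f = t.map f) :
    s.map g = t.map g := by
  rw [← rel_eq, rel_map] at h ⊢
  exact h.mono fun a _ b _ => hfg a b

theorem exists_pairing_of_map_eq_map {α β : Type*} {f : α → β} {s t : Multiset α}
    (h : s.map f = t.map f) :
    ∃ z : Multiset (α × α), z.map Prod.fst = s ∧ z.map Prod.snd = t ∧ ∀ p ∈ z, f p.1 = f p.2 := by
  rw [← rel_eq, rel_map] at h
  induction h with
  | zero => exact ⟨0, by simp⟩
  | cons hab _ ih =>
    obtain ⟨z, rfl, rfl, hz⟩ := ih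
    refine ⟨(_, _) ::ₘ z, map_cons _ _ _, map_cons _ _ _, fun p hp => ?_⟩
    obtain rfl | hp := mem_cons.1 hp
    exacts [hab, hz p hp]

/-! ### Slices and higher Lawrence liftings -/

/-- The slice of `T` at level `k`. -/
noncomputable def slice {K E : Type*} (k : K) (T : Multiset (K × E)) : Multiset E := by
  classical exact (T.filter fun c => c.1 = k).map Prod.snd

theorem slice_map {K E R : Type*} (k : K) (f : E → R) (T : Multiset (K × E)) :
    slice k (T.map (Prod.map id f)) = (slice k T).map f := by
  classical
  simp [slice, filter_map]

/-- Decompositions chosen slice by slice are assembled by labelling each generator with its level.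
`K` may be infinite, but only finitely many levels occur in `T` and `U`. -/
theorem exists_bind_eq_of_slices {K E G : Type*} (X Y : G → Multiset E) (T U : Multiset (K × E))
    (h : ∀ k, ∃ c : Multiset G, c.bind X = slice k T ∧ c.bind Y = slice k U) :
    ∃ c : Multiset (K × G), c.bind (fun q => (X q.2).map (Prod.mk q.1)) = T ∧
      c.bind (fun q => (Y q.2).map (Prod.mk q.1)) = U := by
  classical
  have key : ∀ J : Finset K, ∃ c : Multiset (K × G),
      c.bind (fun q => (X q.2).map (Prod.mk q.1)) = T.filter (fun c => c.1 ∈ J) ∧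
      c.bind (fun q => (Y q.2).map (Prod.mk q.1)) = U.filter (fun c => c.1 ∈ J) := by
    intro J
    induction J using Finset.induction_on with
    | empty => exact ⟨0, by simp⟩
    | insert k J hk ih =>
      obtain ⟨c, hX, hY⟩ := ih
      obtain ⟨c', hX', hY'⟩ := h k
      have aux : ∀ (Z : G → Multiset E) (W : Multiset (K × E)), c'.bind Z = slice k W →
          c.bind (fun q => (Z q.2).map (Prod.mk q.1)) = W.filter (fun c => c.1 ∈ J) →
          (c'.map (Prod.mk k) + c).bind (fun q => (Z q.2).map (Prod.mk q.1)) =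
            W.filter (fun c => c.1 ∈ insert k J) := by
        intro Z W h₁ h₂
        have h₃ : (slice k W).map (Prod.mk k) = W.filter (fun c => c.1 = k) := by
          rw [slice, map_map]
          conv_rhs => rw [← map_id (W.filter fun c => c.1 = k)]
          refine map_congr rfl fun q hq => ?_
          simp [← (mem_filter.1 hq).2]
        rw [h₁.symm, map_bind] at h₃
        rw [add_bind, h₂, bind_map, h₃]
        ext q
        simp only [count_add, count_filter, Finset.mem_insert]
        by_cases hq : q.1 = k
        · simp [hq, hk]
        · simp [hq]
      exact ⟨_, aux X T hX' hX, aux Y U hY' hY⟩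
  obtain ⟨c, hX, hY⟩ := key ((T.map Prod.fst + U.map Prod.fst).toFinset)
  refine ⟨c, hX.trans (filter_eq_self.2 fun q hq => ?_), hY.trans (filter_eq_self.2 fun q hq => ?_)⟩
  · simpa using Or.inl ⟨q.2, hq⟩
  · simpa using Or.inr ⟨q.2, hq⟩

/-- `bind` as an additive map. -/
def bindHom {α β : Type*} (X : α → Multiset β) : Multiset α →+ Multiset β where
  toFun c := c.bind X
  map_zero' := zero_bind X
  map_add' s t := add_bind s t X

/-- All the maps `Multiset.map (f a)` together. -/
def mapHom {α E R : Type*} (f : α → E → R) : Multiset E →+ (α → Multiset R) where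
  toFun s a := s.map (f a)
  map_zero' := by ext; simp
  map_add' s t := by ext; simp

/-- Finiteness of Graver bases of higher Lawrence liftings: pairs of tables with any number of levels
in the first direction, which agree in the `f a`-margins of all slices and in the `g b`-margins of
the sum of the slices, are sums of such pairs of bounded size. -/
theorem exists_bound_lawrence {E R R' α β : Type*} [Finite E] (f : α → E → R) (g : β → E → R') :
    ∃ D : ℕ, ∀ (K : Type) (T U : Multiset (K × E)),
      (∀ a, T.map (Prod.map id (f a)) = U.map (Prod.map id (f a))) →
      (∀ b, T.map (fun c => g b c.2) = U.map (fun c => g b c.2)) →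
      ∃ L : Multiset (Multiset (K × E) × Multiset (K × E)), L.sum = (T, U) ∧
        ∀ p ∈ L, (∀ a, p.1.map (Prod.map id (f a)) = p.2.map (Prod.map id (f a))) ∧
          (∀ b, p.1.map (fun c => g b c.2) = p.2.map (fun c => g b c.2)) ∧ card p.1 ≤ D := by
  classical
  -- `s` generates the pairs of single slices with equal `f a`-margins.
  obtain ⟨s, hs⟩ := AddSubmonoid.fg_eqLocusM
    ((mapHom f).comp (AddMonoidHom.fst (Multiset E) (Multiset E)))
    ((mapHom f).comp (AddMonoidHom.snd (Multiset E) (Multiset E)))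
  let X : {x // x ∈ s} → Multiset E := fun q => q.1.1
  let Y : {x // x ∈ s} → Multiset E := fun q => q.1.2
  have hXY : ∀ q a, (X q).map (f a) = (Y q).map (f a) := by
    intro q a
    have := hs ▸ AddSubmonoid.subset_closure q.2
    exact congrFun this a
  -- Second round, one floor up: `H` generates the multisets of elements of `s` whose total `g
  -- b`-margins agree.
  obtain ⟨H, hH⟩ := AddSubmonoid.fg_eqLocusM
    ((mapHom g).comp (bindHom X)) ((mapHom g).comp (bindHom Y))
  -- Attaching levels to the generators does not change the size of a table, so the bound is
  -- independent of `K`.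
  refine ⟨H.sup fun c => card (c.bind X), fun K T U hf hg => ?_⟩
  obtain ⟨c, rfl, rfl⟩ := exists_bind_eq_of_slices X Y T U (by
    intro k
    have : (slice k T, slice k U) ∈ AddSubmonoid.closure (s : Set (Multiset E × Multiset E)) := by
      rw [hs]
      refine funext fun a => ?_
      change (slice k T).map (f a) = (slice k U).map (f a)
      rw [← slice_map, ← slice_map, hf]
    obtain ⟨l, hl⟩ := exists_sum_of_mem_closure this
    refine ⟨l, ?_, ?_⟩
    · have := congrArg (AddMonoidHom.fst _ _) hl
      rw [map_multiset_sum, map_map] at this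
      exact this
    · have := congrArg (AddMonoidHom.snd _ _) hl
      rw [map_multiset_sum, map_map] at this
      exact this)
  have hmap : ∀ (Z : {x // x ∈ s} → Multiset E)
      (c : Multiset (K × {x // x ∈ s})) (b),
      (c.bind fun q => (Z q.2).map (Prod.mk q.1)).map (fun c => g b c.2) =
        ((c.map Prod.snd).bind Z).map (g b) := by
    intro Z c b
    simp [map_bind, bind_map]
  have hc : c.map Prod.snd ∈ AddSubmonoid.closure (H : Set (Multiset _)) := by
    rw [hH]
    refine funext fun b => ?_
    change ((c.map Prod.snd).bind X).map (g b) = ((c.map Prod.snd).bind Y).map (g b)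
    rw [← hmap, ← hmap, hg]
  -- The `g b`-margins ignore levels: split the unlabelled multiset over `H`, then carry the
  -- splitting back to the labelled one.
  obtain ⟨l, hlH, hl⟩ := AddSubmonoid.exists_multiset_of_mem_closure hc
  obtain ⟨l', rfl, rfl⟩ := exists_sum_of_map_eq_sum _ _ _ hl.symm
  refine ⟨l'.map fun c => (c.bind fun q => (X q.2).map (Prod.mk q.1),
    c.bind fun q => (Y q.2).map (Prod.mk q.1)), ?_, ?_⟩
  · have := map_multiset_sum ((bindHom fun q : K × _ => (X q.2).map (Prod.mk q.1)).prod
      (bindHom fun q : K × _ => (Y q.2).map (Prod.mk q.1))) l'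
    exact this.symm
  · intro p hp
    obtain ⟨c, hc, rfl⟩ := mem_map.1 hp
    have hcH := hlH _ (mem_map_of_mem _ hc)
    refine ⟨fun a => ?_, fun b => ?_, ?_⟩
    · simp only [map_bind, map_map]
      refine bind_congr fun q _ => ?_
      have := congrArg (map (Prod.mk q.1)) (hXY q.2 a)
      simpa [map_map, Function.comp_def] using this
    · simp only [hmap]
      have := hH ▸ AddSubmonoid.subset_closure hcH
      exact congrFun this b
    · refine le_trans (le_of_eq ?_) (Finset.le_sup (f := fun c => card (c.bind X)) hcH)
      simp [card_bind]

end Multiset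

/-! ### Tables as multisets of cells -/

namespace TableComplex

open Multiset Relation

section Margins

variable {V : Type*} {d : V → ℕ}

/-- The restriction of a cell to a set of vertices. -/
def restrictCell (P : Set V) (c : Cell d) : (j : {j // j ∈ P}) → Fin (d j.1) := fun j => c j.1

theorem restrictCell_eq_iff {P : Set V} {c c' : Cell d} :
    restrictCell P c = restrictCell P c' ↔ ∀ j ∈ P, c j = c' j := by
  simp [restrictCell, funext_iff]

/-- Two tables, as multisets of cells, have the same margins along all faces of `Δ`. -/
def SameMargins (Δ : TableComplex V) (X Y : Multiset (Cell d)) : Prop :=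
  ∀ F ∈ Δ.faces, X.map (restrictCell (F : Set V)) = Y.map (restrictCell (F : Set V))

theorem map_restrictCell_mono {P Q : Set V} (hPQ : P ⊆ Q) {X Y : Multiset (Cell d)}
    (h : X.map (restrictCell Q) = Y.map (restrictCell Q)) :
    X.map (restrictCell P) = Y.map (restrictCell P) :=
  map_eq_map_of_factors
    (fun _ _ hab => restrictCell_eq_iff.2 fun j hj => restrictCell_eq_iff.1 hab j (hPQ hj)) h

theorem subset_support {Δ : TableComplex V} {F : Finset V} (hF : F ∈ Δ.faces) :
    (F : Set V) ⊆ Δ.support :=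
  fun _ hj => ⟨F, hF, hj⟩

theorem SameMargins.card_eq {Δ : TableComplex V} {X Y : Multiset (Cell d)}
    (h : Δ.SameMargins X Y) : Multiset.card X = Multiset.card Y := by
  simpa using congrArg Multiset.card (h ∅ Δ.empty_mem)

theorem IsReducible.symm {Δ Δ₁ Δ₂ : TableComplex V} {S : Finset V}
    (h : Δ.IsReducible Δ₁ S Δ₂) : Δ.IsReducible Δ₂ S Δ₁ :=
  ⟨h.mem_right, h.mem_left, by rw [Set.inter_comm, h.support_inter], by
    rw [h.faces_eq, Set.union_comm]⟩

theorem IsReducible.sameMargins {Δ Δ₁ Δ₂ : TableComplex V} {S : Finset V}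
    (h : Δ.IsReducible Δ₁ S Δ₂) {X Y : Multiset (Cell d)} (h₁ : Δ₁.SameMargins X Y)
    (h₂ : Δ₂.SameMargins X Y) : Δ.SameMargins X Y := by
  intro F hF
  rw [h.faces_eq] at hF
  exact hF.elim (h₁ F) (h₂ F)

theorem IsReducible.sameMargins_left {Δ Δ₁ Δ₂ : TableComplex V} {S : Finset V}
    (h : Δ.IsReducible Δ₁ S Δ₂) {X Y : Multiset (Cell d)} (hXY : Δ.SameMargins X Y) :
    Δ₁.SameMargins X Y :=
  fun F hF => hXY F (h.faces_eq ▸ Or.inl hF)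

theorem SameMargins.of_support {Δ : TableComplex V} {X Y : Multiset (Cell d)}
    (h : X.map (restrictCell Δ.support) = Y.map (restrictCell Δ.support)) : Δ.SameMargins X Y :=
  fun _ hF => map_restrictCell_mono (subset_support hF) h

open Classical in
/-- The cell that agrees with `c` on `P` and with `c'` elsewhere. -/
noncomputable def glueCell (P : Set V) (c c' : Cell d) : Cell d :=
  fun j => if j ∈ P then c j else c' j

theorem restrictCell_glueCell (P : Set V) (c c' : Cell d) :
    restrictCell P (glueCell P c c') = restrictCell P c :=
  restrictCell_eq_iff.2 fun _ hj => if_pos hj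

theorem restrictCell_glueCell_right {P Q : Set V} {c c' : Cell d}
    (h : ∀ j ∈ P ∩ Q, c j = c' j) :
    restrictCell Q (glueCell P c c') = restrictCell Q c' := by
  refine restrictCell_eq_iff.2 fun j hj => ?_
  unfold glueCell
  split_ifs with hP
  exacts [h j ⟨hP, hj⟩, rfl]

/-! ### Connecting tables over a reducible complex -/

/-- `U` arises from `T` by a move of degree at most `D` that preserves the `Δ`-margins. -/
def MoveStep (Δ : TableComplex V) (D : ℕ) (T U : Multiset (Cell d)) : Prop :=
  ∃ W X Y : Multiset (Cell d), T = W + X ∧ U = W + Y ∧ Multiset.card X ≤ D ∧ Δ.SameMargins X Y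

theorem MoveStep.add_left {Δ : TableComplex V} {D : ℕ} {T U : Multiset (Cell d)}
    (h : Δ.MoveStep D T U) (W : Multiset (Cell d)) : Δ.MoveStep D (W + T) (W + U) := by
  obtain ⟨W', X, Y, rfl, rfl, hD, hXY⟩ := h
  exact ⟨W + W', X, Y, by rw [add_assoc], by rw [add_assoc], hD, hXY⟩

theorem reflTransGen_moveStep_add_left {Δ : TableComplex V} {D : ℕ} {T U : Multiset (Cell d)}
    (h : ReflTransGen (Δ.MoveStep D) T U) (W : Multiset (Cell d)) :
    ReflTransGen (Δ.MoveStep D) (W + T) (W + U) :=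
  ReflTransGen.lift (W + ·) (fun _ _ hab => MoveStep.add_left hab W) _ _ h

/-- Any two tables with the same `Δ`-margins split into pairs of such tables of size at most `D`. -/
def BoundedSplitting (Δ : TableComplex V) (d : V → ℕ) (D : ℕ) : Prop :=
  ∀ T U : Multiset (Cell d), Δ.SameMargins T U →
    ∃ L : Multiset (Multiset (Cell d) × Multiset (Cell d)), L.sum = (T, U) ∧
      ∀ p ∈ L, Δ.SameMargins p.1 p.2 ∧ Multiset.card p.1 ≤ D

/-- A move for `Δ₁` lifts to one for `Δ` which leaves the part of the table over `Δ₂` alone. -/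
theorem IsReducible.exists_lift {Δ Δ₁ Δ₂ : TableComplex V} {S : Finset V}
    (h : Δ.IsReducible Δ₁ S Δ₂) {T U : Multiset (Cell d)} (hTU : Δ₁.SameMargins T U) :
    ∃ T' : Multiset (Cell d), T'.map (restrictCell Δ₁.support) = U.map (restrictCell Δ₁.support) ∧
      T'.map (restrictCell Δ₂.support) = T.map (restrictCell Δ₂.support) ∧ Δ.SameMargins T T' := by
  -- `S` is a face of `Δ₁`, so the cells of `T` and `U` can be matched to agree on `S`; each pair is
  -- then glued along `S`.
  obtain ⟨z, rfl, rfl, hz⟩ := exists_pairing_of_map_eq_map (hTU S h.mem_left)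
  have h₁ : (z.map fun p => glueCell Δ₁.support p.2 p.1).map (restrictCell Δ₁.support) =
      (z.map Prod.snd).map (restrictCell Δ₁.support) := by
    simp [Multiset.map_map, restrictCell_glueCell]
  have h₂ : (z.map fun p => glueCell Δ₁.support p.2 p.1).map (restrictCell Δ₂.support) =
      (z.map Prod.fst).map (restrictCell Δ₂.support) := by
    rw [Multiset.map_map, Multiset.map_map]
    refine Multiset.map_congr rfl fun p hp => restrictCell_glueCell_right fun j hj => ?_
    rw [h.support_inter] at hj
    exact (restrictCell_eq_iff.1 (hz p hp) j hj).symm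
  refine ⟨_, h₁, h₂, h.sameMargins (fun F hF => ?_) (SameMargins.of_support h₂.symm)⟩
  exact (hTU F hF).trans (SameMargins.of_support h₁.symm F hF)

/-- Each small piece of the splitting is lifted separately and applied while the rest of the table
stays fixed. -/
theorem IsReducible.exists_reflTransGen_lift {Δ Δ₁ Δ₂ : TableComplex V} {S : Finset V}
    (h : Δ.IsReducible Δ₁ S Δ₂) {D : ℕ} (hD : Δ₁.BoundedSplitting d D)
    {T U : Multiset (Cell d)} (hTU : Δ₁.SameMargins T U) :
    ∃ T' : Multiset (Cell d), T'.map (restrictCell Δ₁.support) = U.map (restrictCell Δ₁.support) ∧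
      T'.map (restrictCell Δ₂.support) = T.map (restrictCell Δ₂.support) ∧
      ReflTransGen (Δ.MoveStep D) T T' := by
  obtain ⟨L, hL, hp⟩ := hD T U hTU
  clear hTU
  induction L using Multiset.induction_on generalizing T U with
  | empty =>
    obtain ⟨rfl, rfl⟩ := Prod.mk.inj hL
    exact ⟨0, rfl, rfl, .refl⟩
  | cons p L ih =>
    rw [Multiset.sum_cons] at hL
    obtain ⟨T₁, U₁, hT₁⟩ : ∃ T₁ U₁, L.sum = (T₁, U₁) := ⟨_, _, rfl⟩
    rw [hT₁] at hL
    obtain ⟨rfl, rfl⟩ := Prod.mk.inj hL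
    obtain ⟨T', hT'₁, hT'₂, hT'⟩ := ih hT₁ fun q hq => hp q (mem_cons_of_mem hq)
    obtain ⟨hpΔ, hpD⟩ := hp p (mem_cons_self p L)
    obtain ⟨X, hX₁, hX₂, hX⟩ := h.exists_lift hpΔ
    refine ⟨X + T', by simp [hX₁, hT'₁], by simp [hX₂, hT'₂],
      (reflTransGen_moveStep_add_left hT' p.1).trans (.single ?_)⟩
    exact ⟨T', p.1, X, add_comm _ _, add_comm _ _, hpD, hX⟩

theorem MoveStep.mono {Δ : TableComplex V} {D D' : ℕ} (hD : D ≤ D') {T U : Multiset (Cell d)}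
    (h : Δ.MoveStep D T U) : Δ.MoveStep D' T U := by
  obtain ⟨W, X, Y, hT, hU, hX, hXY⟩ := h
  exact ⟨W, X, Y, hT, hU, hX.trans hD, hXY⟩

theorem reflTransGen_moveStep_mono {Δ : TableComplex V} {D D' : ℕ} (hD : D ≤ D')
    {T U : Multiset (Cell d)} (h : ReflTransGen (Δ.MoveStep D) T U) :
    ReflTransGen (Δ.MoveStep D') T U :=
  ReflTransGen.mono (fun _ _ => MoveStep.mono hD) _ _ h

/-- Tables that agree over both parts of a decomposition are connected by quadratic moves. -/
theorem IsReducible.reflTransGen_of_supports {Δ Δ₁ Δ₂ : TableComplex V} {S : Finset V}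
    (h : Δ.IsReducible Δ₁ S Δ₂) (U : Multiset (Cell d)) (T : Multiset (Cell d))
    (h₁ : T.map (restrictCell Δ₁.support) = U.map (restrictCell Δ₁.support))
    (h₂ : T.map (restrictCell Δ₂.support) = U.map (restrictCell Δ₂.support)) :
    ReflTransGen (Δ.MoveStep 2) T U := by
  induction U using Multiset.induction_on generalizing T with
  | empty =>
    obtain rfl : T = 0 := by simpa using h₁
    exact .refl
  | cons u U ih =>
    obtain ⟨t, ht, htu⟩ := Multiset.mem_map.1
      (h₁ ▸ mem_map_of_mem _ (mem_cons_self u U) : _ ∈ T.map (restrictCell Δ₁.support))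
    obtain ⟨t', ht', htu'⟩ := Multiset.mem_map.1
      (h₂ ▸ mem_map_of_mem _ (mem_cons_self u U) : _ ∈ T.map (restrictCell Δ₂.support))
    obtain ⟨T₁, rfl⟩ := exists_cons_of_mem ht
    obtain rfl | ht' := mem_cons.1 ht'
    -- The two supports need not cover `V`, so `t'` may still differ from `u`; a move of degree one
    -- corrects this.
    · have hstep : Δ.MoveStep 2 (t' ::ₘ T₁) (u ::ₘ T₁) := by
        refine ⟨T₁, {t'}, {u}, by rw [add_comm, singleton_add], by rw [add_comm, singleton_add], by simp, ?_⟩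
        exact h.sameMargins (.of_support (by simp [htu])) (.of_support (by simp [htu']))
      refine .head hstep ?_
      have := ih T₁ (by simpa [htu] using h₁) (by simpa [htu'] using h₂)
      simpa only [singleton_add] using reflTransGen_moveStep_add_left this {u}
    -- Here `t` supplies the `Δ₁`-half of `u` and `t'` the `Δ₂`-half. The swap creates `u`, and `g`
    -- takes the two leftover halves, which match on `S` because `t` and `t'` both agree with `u`
    -- there.
    · obtain ⟨T₂, rfl⟩ := exists_cons_of_mem ht'
      have hg₁ := restrictCell_glueCell Δ₁.support t' t
      have hg₂ : restrictCell Δ₂.support (glueCell Δ₁.support t' t) =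
          restrictCell Δ₂.support t := by
        refine restrictCell_glueCell_right fun j hj => ?_
        rw [restrictCell_eq_iff.1 htu' j hj.2, restrictCell_eq_iff.1 htu j hj.1]
      set g := glueCell Δ₁.support t' t
      have hstep : Δ.MoveStep 2 (t ::ₘ t' ::ₘ T₂) (u ::ₘ g ::ₘ T₂) := by
        refine ⟨T₂, {t, t'}, {u, g}, by rw [add_comm]; simp, by rw [add_comm]; simp, by simp, ?_⟩
        refine h.sameMargins (.of_support ?_) (.of_support ?_)
        · simp [htu, hg₁]
        · simpa [htu', hg₂] using Multiset.pair_comm _ _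
      refine .head hstep ?_
      have := ih (g ::ₘ T₂) (by simpa [htu, hg₁] using h₁) (by
        rw [Multiset.map_cons, Multiset.map_cons, Multiset.cons_swap] at h₂
        simpa [htu', hg₂] using h₂)
      simpa only [singleton_add] using reflTransGen_moveStep_add_left this {u}

/-- Markov bases of reducible models: lifted moves of the two parts together with quadratic moves
connect all fibers. -/
theorem IsReducible.reflTransGen_moveStep {Δ Δ₁ Δ₂ : TableComplex V} {S : Finset V}
    (h : Δ.IsReducible Δ₁ S Δ₂) {D₁ D₂ : ℕ} (hD₁ : Δ₁.BoundedSplitting d D₁)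
    (hD₂ : Δ₂.BoundedSplitting d D₂) {T U : Multiset (Cell d)} (hTU : Δ.SameMargins T U) :
    ReflTransGen (Δ.MoveStep (D₁ + D₂ + 2)) T U := by
  obtain ⟨T', h₁, h₂, hT⟩ := h.exists_reflTransGen_lift hD₁ (h.sameMargins_left hTU)
  have hT'U : Δ₂.SameMargins T' U := fun F hF =>
    (SameMargins.of_support h₂ F hF).trans (h.symm.sameMargins_left hTU F hF)
  obtain ⟨T'', h₃, h₄, hT'⟩ := h.symm.exists_reflTransGen_lift hD₂ hT'U
  have hT₃ := h.reflTransGen_of_supports U T'' (h₄.trans h₁) h₃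
  exact ((reflTransGen_moveStep_mono (by omega) hT).trans
    (reflTransGen_moveStep_mono (by omega) hT')).trans (reflTransGen_moveStep_mono (by omega) hT₃)

end Margins

/-! ### Uniform splittings for one part -/

/-- If one direction `w` is irrelevant to `Δ` and all others but `v` have a fixed number of levels,
then `Δ` has splittings of bounded size. -/
theorem exists_boundedSplitting {n : ℕ} (Δ : TableComplex (Fin (n + 2))) (v w : Fin (n + 2))
    (hvw : ∀ j, j = v ∨ j = w ∨ ∃ i : Fin n, j = i.succ.succ) (hw : w ∉ Δ.support)
    (d' : Fin n → ℕ) :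
    ∃ D : ℕ, ∀ d : Fin (n + 2) → ℕ, (∀ i : Fin n, d i.succ.succ = d' i) →
      Δ.BoundedSplitting d D := by
  classical
  -- Masking the coordinates outside `F` by `none` gives the margins of all faces one common type,
  -- fixed by `d'`.
  let mask : Finset (Fin (n + 2)) → ((i : Fin n) → Fin (d' i)) → (i : Fin n) → Option (Fin (d' i)) :=
    fun F e i => if i.succ.succ ∈ F then some (e i) else none
  have hmask : ∀ F e e', mask F e = mask F e' ↔ ∀ i : Fin n, i.succ.succ ∈ F → e i = e' i := by
    intro F e e'
    rw [funext_iff]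
    refine forall_congr' fun i => ?_
    by_cases hi : i.succ.succ ∈ F <;> simp [mask, hi]
  -- Levels of `v` index the slices: faces containing `v` compare tables slice by slice, the others
  -- only compare sums of slices.
  obtain ⟨D, hD⟩ := exists_bound_lawrence
    (fun F : {F : Finset (Fin (n + 2)) // F ∈ Δ.faces ∧ v ∈ F} => mask F.1)
    (fun F : {F : Finset (Fin (n + 2)) // F ∈ Δ.faces} => mask F.1)
  refine ⟨D, fun d hd T U hTU => ?_⟩
  obtain rfl : d' = fun i => d i.succ.succ := funext fun i => (hd i).symm
  -- `π` forgets the coordinate `w`, which no face sees; the splitting found below `π` is lifted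
  -- back to cells.
  let π : Cell d → Fin (d v) × ((i : Fin n) → Fin (d i.succ.succ)) :=
    fun c => (c v, fun i => c i.succ.succ)
  obtain ⟨L, hL, hp⟩ := hD (Fin (d v)) (T.map π) (U.map π) (by
    rintro ⟨F, hF, hv⟩
    rw [Multiset.map_map, Multiset.map_map]
    refine map_eq_map_of_factors (fun a b hab => ?_) (hTU F hF)
    rw [restrictCell_eq_iff] at hab
    exact Prod.ext (hab v hv) ((hmask _ _ _).2 fun i hi => hab _ hi)) (by
    rintro ⟨F, hF⟩
    rw [Multiset.map_map, Multiset.map_map]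
    refine map_eq_map_of_factors (fun a b hab => ?_) (hTU F hF)
    rw [restrictCell_eq_iff] at hab
    exact (hmask _ _ _).2 fun i hi => hab _ hi)
  obtain ⟨L', hL', rfl⟩ := exists_sum_of_prodMap_eq_sum π L (T, U) hL.symm
  refine ⟨L', hL', fun p hpL => ?_⟩
  obtain ⟨hf, hg, hcard⟩ := hp _ (mem_map_of_mem _ hpL)
  refine ⟨fun F hF => ?_, by simpa using hcard⟩
  by_cases hv : v ∈ F
  · have := hf ⟨F, hF, hv⟩
    rw [Multiset.map_map, Multiset.map_map] at this
    refine map_eq_map_of_factors (fun a b hab => restrictCell_eq_iff.2 fun j hj => ?_) this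
    obtain ⟨hab₁, hab₂⟩ := Prod.ext_iff.1 hab
    obtain rfl | rfl | ⟨i, rfl⟩ := hvw j
    exacts [hab₁, absurd ⟨F, hF, hj⟩ hw, (hmask _ _ _).1 hab₂ i hj]
  · have := hg ⟨F, hF⟩
    rw [Multiset.map_map, Multiset.map_map] at this
    refine map_eq_map_of_factors (fun a b hab => restrictCell_eq_iff.2 fun j hj => ?_) this
    obtain rfl | rfl | ⟨i, rfl⟩ := hvw j
    exacts [absurd hj hv, absurd ⟨F, hF, hj⟩ hw, (hmask _ _ _).1 hab i hj]

end TableComplex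

/-! ### Minimal Markov bases -/

/-- `u` arises from `t` by applying one move of `M`. -/
def FiberStep {κ : Type*} (M : Set (κ → ℤ)) (t u : κ → ℕ) : Prop :=
  ∃ v ∈ M, ∀ k, (u k : ℤ) = t k + v k

theorem exists_moves_of_reflTransGen_fiberStep {κ : Type*} {M : Set (κ → ℤ)} {t u : κ → ℕ}
    (h : Relation.ReflTransGen (FiberStep M) t u) :
    ∃ (s : ℕ) (v : ℕ → κ → ℤ), (∀ i < s, v i ∈ M) ∧
      (∀ p ≤ s, ∀ k, 0 ≤ (t k : ℤ) + ∑ i ∈ Finset.range p, v i k) ∧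
      ∀ k, (t k : ℤ) + ∑ i ∈ Finset.range s, v i k = (u k : ℤ) := by
  induction h with
  | refl => exact ⟨0, 0, by simp, by simp, by simp⟩
  | @tail b c _ hbc ih =>
    obtain ⟨s, v, hv, hpos, hsum⟩ := ih
    obtain ⟨w, hw, hc⟩ := hbc
    have hlt : ∀ i < s, Function.update v s w i = v i := fun i hi =>
      Function.update_of_ne hi.ne _ _
    have hsum' : ∀ p ≤ s, ∀ k,
        ∑ i ∈ range p, Function.update v s w i k = ∑ i ∈ range p, v i k := fun p hp k =>
      sum_congr rfl fun i hi => by rw [hlt i (lt_of_lt_of_le (mem_range.1 hi) hp)]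
    have hend : ∀ k, (t k : ℤ) + ∑ i ∈ range (s + 1), Function.update v s w i k = c k := by
      intro k
      rw [sum_range_succ, hsum' s le_rfl, Function.update_self, ← add_assoc, hsum, hc]
    refine ⟨s + 1, Function.update v s w, fun i hi => ?_, fun p hp k => ?_, hend⟩
    · obtain hi | rfl := Nat.lt_succ_iff_lt_or_eq.1 hi
      · rw [hlt i hi]
        exact hv i hi
      · rwa [Function.update_self]
    · obtain hp | rfl := Nat.le_succ_iff.1 hp
      · rw [hsum' p hp]
        exact hpos p hp k
      · rw [hend]
        positivity

/-- A Markov basis connects a fiber of degree at most `D` with moves of norm at most `2 * D`. -/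
theorem IsMarkovBasis.reflTransGen_fiberStep {ι κ : Type*} [Fintype κ] {A : Matrix ι κ ℕ}
    {M : Set (κ → ℤ)} (hM : IsMarkovBasis A M)
    (hA : ∀ v : κ → ℤ, A.map (fun a : ℕ => (a : ℤ)) *ᵥ v = 0 → ∑ k, v k = 0)
    {D : ℕ} {t u : κ → ℕ} (htD : ∑ k, t k ≤ D) (htu : A *ᵥ t = A *ᵥ u) :
    Relation.ReflTransGen (FiberStep {v ∈ M | ∑ k, (v k).natAbs ≤ 2 * D}) t u := by
  obtain ⟨s, v, hv, hpos, hsum⟩ := hM.connected t u htu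
  let w : ℕ → κ → ℕ := fun p k => ((t k : ℤ) + ∑ i ∈ range p, v i k).toNat
  have hw : ∀ p ≤ s, ∀ k, (w p k : ℤ) = t k + ∑ i ∈ range p, v i k := fun p hp k =>
    Int.toNat_of_nonneg (hpos p hp k)
  have hdeg : ∀ p ≤ s, ∑ k, w p k ≤ D := by
    intro p hp
    have h₀ : ∑ k, ∑ i ∈ range p, v i k = 0 := by
      rw [sum_comm]
      exact sum_eq_zero fun i hi =>
        hA _ (hM.mem_ker _ (hv i (lt_of_lt_of_le (mem_range.1 hi) hp)))
    have h₁ : ((∑ k, w p k : ℕ) : ℤ) = ((∑ k, t k : ℕ) : ℤ) := by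
      push_cast
      rw [sum_congr rfl fun k _ => hw p hp k, sum_add_distrib, h₀, add_zero]
    have := Int.ofNat_inj.1 h₁
    omega
  have key : ∀ p ≤ s, Relation.ReflTransGen
      (FiberStep {v ∈ M | ∑ k, (v k).natAbs ≤ 2 * D}) t (w p) := by
    intro p
    induction p with
    | zero =>
      intro _
      have : w 0 = t := by ext k; simp [w]
      rw [this]
    | succ p ih =>
      intro hp
      have hstep : ∀ k, (w (p + 1) k : ℤ) = w p k + v p k := fun k => by
        rw [hw _ hp, hw _ (Nat.le_of_succ_le hp), sum_range_succ, add_assoc]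
      refine (ih (Nat.le_of_succ_le hp)).tail ⟨v p, ⟨hv p hp, ?_⟩, hstep⟩
      calc ∑ k, (v p k).natAbs ≤ ∑ k, (w p k + w (p + 1) k) :=
            sum_le_sum fun k _ => by have := hstep k; omega
        _ ≤ 2 * D := by
            rw [sum_add_distrib]
            have h₁ := hdeg p (Nat.le_of_succ_le hp)
            have h₂ := hdeg (p + 1) hp
            omega
  have : w s = u := by
    ext k
    have := hw s le_rfl k
    rw [hsum] at this
    exact_mod_cast this
  exact this ▸ key s le_rfl

namespace TableComplex

theorem exists_subset_facet {V : Type*} [Finite V] (Δ : TableComplex V) {F : Finset V} (hF : F ∈ Δ.faces) :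
    ∃ G ∈ Δ.facets, F ⊆ G := by
  obtain ⟨G, hFG, hG⟩ := (Set.toFinite Δ.faces).exists_le_maximal hF
  exact ⟨G, ⟨hG.prop, fun H hH hGH => hG.eq_of_le hH hGH⟩, hFG⟩

theorem format_le {V : Type*} {d : V → ℕ} (u : Cell d → ℤ) (i : V) : format u i ≤ d i := by
  refine (Set.ncard_le_ncard (Set.subset_univ _)).trans ?_
  simp [Set.ncard_univ]

section Matrix

variable {V : Type*} [Fintype V] [DecidableEq V] {d : V → ℕ}

theorem modelMatrix_mulVec_count (Δ : TableComplex V) (T : Multiset (Cell d)) (r : Δ.Row d) :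
    (Δ.modelMatrix d *ᵥ fun c => T.count c) r =
      (T.map (restrictCell (r.1.1 : Set V))).count r.2 := by
  have hr : ∀ c : Cell d,
      (∀ j : {j : V // j ∈ r.1.1}, c j.1 = r.2 j) ↔ r.2 = restrictCell (r.1.1 : Set V) c :=
    fun c => ⟨fun h => funext fun j => (h j).symm, fun h j => (congrFun h j).symm⟩
  simp only [mulVec, dotProduct, modelMatrix, of_apply, hr]
  induction T using Multiset.induction_on with
  | empty => simp
  | cons a T ih =>
    rw [Multiset.map_cons, Multiset.count_cons, ← ih]
    simp [Multiset.count_cons, mul_add, sum_add_distrib]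

theorem modelMatrix_mulVec_count_eq_iff (Δ : TableComplex V) (T U : Multiset (Cell d)) :
    ((Δ.modelMatrix d *ᵥ fun c => T.count c) = Δ.modelMatrix d *ᵥ fun c => U.count c) ↔
      Δ.SameMargins T U := by
  constructor
  · intro h F hF
    obtain ⟨G, hG, hFG⟩ := Δ.exists_subset_facet hF
    refine map_restrictCell_mono (Finset.coe_subset.2 hFG) (Multiset.ext.2 fun e => ?_)
    have := congrFun h ⟨⟨G, hG⟩, e⟩
    rwa [modelMatrix_mulVec_count, modelMatrix_mulVec_count] at this
  · intro h
    ext r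
    rw [modelMatrix_mulVec_count, modelMatrix_mulVec_count, h _ r.1.2.1]

theorem sum_eq_zero_of_modelMatrix_mulVec (Δ : TableComplex V) (v : Cell d → ℤ)
    (hv : (Δ.modelMatrix d).map (fun a : ℕ => (a : ℤ)) *ᵥ v = 0) : ∑ c, v c = 0 := by
  obtain ⟨G, hG, -⟩ := Δ.exists_subset_facet Δ.empty_mem
  rw [← Finset.sum_fiberwise (s := univ)
    (g := fun (c : Cell d) (j : {j : V // j ∈ G}) => c j.1) (f := v)]
  refine sum_eq_zero fun e _ => ?_
  have := congrFun hv ⟨⟨G, hG⟩, e⟩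
  simp only [mulVec, dotProduct, modelMatrix, map_apply, of_apply, Pi.zero_apply] at this
  rw [← this, sum_filter]
  refine sum_congr rfl fun c _ => ?_
  simp [funext_iff]

/-- If moves of degree at most `D` connect all fibers, then the elements of bounded norm of a Markov
basis form a Markov basis. -/
theorem isMarkovBasis_bounded (Δ : TableComplex V) {D : ℕ} {M : Set (Cell d → ℤ)}
    (hM : IsMarkovBasis (Δ.modelMatrix d) M)
    (hD : ∀ T U : Multiset (Cell d), Δ.SameMargins T U →
      Relation.ReflTransGen (Δ.MoveStep D) T U) :
    IsMarkovBasis (Δ.modelMatrix d) {v ∈ M | ∑ c, (v c).natAbs ≤ 2 * D} := by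
  refine ⟨hM.finite.subset fun _ h => h.1, fun v hv => hM.mem_ker v hv.1, fun t u htu => ?_⟩
  refine exists_moves_of_reflTransGen_fiberStep ?_
  have hsurj : ∀ t : Cell d → ℕ, ∃ T : Multiset (Cell d), t = fun c => T.count c := fun t =>
    ⟨Finsupp.toMultiset (Finsupp.equivFunOnFinite.symm t), by
      ext c; simp [Finsupp.count_toMultiset]⟩
  obtain ⟨T, rfl⟩ := hsurj t
  obtain ⟨U, rfl⟩ := hsurj u
  have hTU := hD T U ((Δ.modelMatrix_mulVec_count_eq_iff T U).1 htu)
  clear htu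
  induction hTU with
  | refl => exact .refl
  | tail _ hstep ih =>
    refine ih.trans ?_
    obtain ⟨W, X, Y, rfl, rfl, hX, hXY⟩ := hstep
    have h := hM.reflTransGen_fiberStep Δ.sum_eq_zero_of_modelMatrix_mulVec (D := D)
      (t := fun c => X.count c) (u := fun c => Y.count c)
      (by rwa [Multiset.sum_count_eq_card fun _ _ => mem_univ _])
      ((Δ.modelMatrix_mulVec_count_eq_iff X Y).2 hXY)
    have := Relation.ReflTransGen.lift
      (p := FiberStep {v ∈ M | ∑ c, (v c).natAbs ≤ 2 * D})
      (fun t : Cell d → ℕ => fun c => W.count c + t c) (by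
        rintro t u ⟨v, hv, hvu⟩
        refine ⟨v, hv, fun c => ?_⟩
        have := hvu c
        push_cast
        linarith) _ _ h
    simpa only [Function.onFun, ← Multiset.count_add] using this

theorem sum_natAbs_le_of_mem_universalMarkovBasis (Δ : TableComplex V) {D : ℕ}
    (hD : ∀ T U : Multiset (Cell d), Δ.SameMargins T U →
      Relation.ReflTransGen (Δ.MoveStep D) T U)
    {u : Cell d → ℤ} (hu : u ∈ universalMarkovBasis (Δ.modelMatrix d)) :
    ∑ c, (u c).natAbs ≤ 2 * D := by
  obtain ⟨M, ⟨hM, hmin⟩, huM⟩ := hu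
  by_contra hlt
  exact hmin _ ⟨fun _ h => h.1, fun h => hlt (h huM).2⟩ (Δ.isMarkovBasis_bounded hM hD)

theorem format_le_sum_natAbs (u : Cell d → ℤ) (i : V) : format u i ≤ ∑ c, (u c).natAbs := by
  have himage : {k : Fin (d i) | ∃ c : Cell d, c i = k ∧ u c ≠ 0} =
      (fun c : Cell d => c i) '' ((univ.filter fun c => u c ≠ 0 : Finset (Cell d)) : Set _) := by
    ext k
    simp [and_comm]
  rw [format, himage]
  refine (Set.ncard_image_le (Finset.finite_toSet _)).trans ?_
  rw [Set.ncard_coe_finset, card_eq_sum_ones, sum_filter]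
  refine sum_le_sum fun c _ => ?_
  split_ifs <;> omega

end Matrix

end TableComplex

theorem corollary4p4 (n : ℕ) (Δ Δ₁ Δ₂ : TableComplex (Fin (n + 2))) (S : Finset (Fin (n + 2)))
    (hred : Δ.IsReducible Δ₁ S Δ₂)
    (h1 : (0 : Fin (n + 2)) ∈ Δ₁.support \ Δ₂.support)
    (h2 : (1 : Fin (n + 2)) ∈ Δ₂.support \ Δ₁.support)
    (d' : Fin n → ℕ) :
    ∃ m₁ m₂ : ℕ, ∀ d : Fin (n + 2) → ℕ, (∀ i : Fin n, d i.succ.succ = d' i) →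
      ∀ u ∈ universalMarkovBasis (Δ.modelMatrix d),
        TableComplex.format u 0 < m₁ ∧ TableComplex.format u 1 < m₂ ∧
          ∀ i : Fin n, TableComplex.format u i.succ.succ ≤ d' i := by
  have hcases : ∀ j : Fin (n + 2), j = 0 ∨ j = 1 ∨ ∃ i : Fin n, j = i.succ.succ := by
    intro j
    refine Fin.cases (Or.inl rfl) (fun j => ?_) j
    refine Fin.cases (Or.inr (Or.inl rfl)) (fun j => ?_) j
    exact Or.inr (Or.inr ⟨j, rfl⟩)
  obtain ⟨D₁, hD₁⟩ := TableComplex.exists_boundedSplitting Δ₁ 0 1 hcases h2.2 d'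
  obtain ⟨D₂, hD₂⟩ := TableComplex.exists_boundedSplitting Δ₂ 1 0
    (fun j => or_left_comm.1 (hcases j)) h1.2 d'
  refine ⟨2 * (D₁ + D₂ + 2) + 1, 2 * (D₁ + D₂ + 2) + 1, fun d hd u hu => ?_⟩
  have hle := Δ.sum_natAbs_le_of_mem_universalMarkovBasis
    (fun T U hTU => hred.reflTransGen_moveStep (hD₁ d hd) (hD₂ d hd) hTU) hu
  exact ⟨Nat.lt_succ_of_le ((TableComplex.format_le_sum_natAbs u 0).trans hle),
    Nat.lt_succ_of_le ((TableComplex.format_le_sum_natAbs u 1).trans hle),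
    fun i => hd i ▸ TableComplex.format_le u i.succ.succ⟩
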